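/- Modal formulas are built from literals ($p$ or $\neg p$, where $p$ ranges over a fixed countably infinite set of variables) and the constants $\bot,\top$ by $\wedge,\vee,\Diamond,\Box$; negation is defined by the duality laws, $\varphi\to\psi$ is $\neg\varphi\vee\psi$, and $\varphi(\vec p,\bar r)$ means that all variables of $\varphi$ are among $\vec p,\bar r$. A modal logic is a set of formulas that contains all classical tautologies and is closed under modus ponens, substitution and the rule $\varphi\leftrightarrow\psi \,/\, \Diamond\varphi\leftrightarrow\Diamond\psi$; it is monotone if it contains $\Diamond p\to\Diamond(p\vee q)$. Let $\Lambda$ be a monotone modal logic, and let $\vec p=(p_i)_{i<n'}$, $\bar r=(r_j)_{j<m'}$ be tuples of variables, all of them distinct. A formula $\varphi(\vec p,\bar r)$ is $\vec p$-positive if no literal $\neg p_i$ occurs in it, and $\vec p$-monotone in $\Lambda$ if $\varphi(\vec p,\bar r)\to\varphi(\vec p\vee\vec q,\bar r)$ belongs to $\Lambda$, where $\vec q=(q_i)_{i<n'}$ are distinct fresh variables and $\vec p\vee\vec q=(p_i\vee q_i)_{i<n'}$. The logic $\Lambda$ has $\mathrm{LPP}(n,m)$ (the graded Lyndon positivity property)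 if for all finite $n'\le n$, $m'\le m$ and all such tuples $\vec p=(p_i)_{i<n'}$, $\bar r=(r_j)_{j<m'}$, every formula $\varphi(\vec p,\bar r)$ that is $\vec p$-monotone in $\Lambda$ is $\Lambda$-equivalent to some $\vec p$-positive formula $\alpha(\vec p,\bar r)$, that is, $\varphi\leftrightarrow\alpha$ belongs to $\Lambda$. For $1\le k\le\omega$ let $\mathcal C_k$ be the Kripke frame (cluster) whose worlds are the natural numbers $i<k$ and in which every world is accessible from every world, and let $\mathrm{Log}\,\mathcal C_k$ be the set of all formulas valid in $\mathcal C_k$, i.e. true at every world under every valuation. Proposition. Let $n,m<\omega$ and $k\le\omega$. If $k\ge 2^{2n+m}$, then $\mathrm{Log}\,\mathcal C_k$ is a monotone modal logic and has $\mathrm{LPP}(n,m)$. -/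

import Mathlib

namespace ModalLyndon

/-- Literals: variables (indexed by `ℕ`) and negations of variables. -/
inductive Literal : Type
  | pos (p : ℕ) : Literal
  | neg (p : ℕ) : Literal

/-- The variable of a literal. -/
def Literal.variable : Literal → ℕ
  | .pos p => p
  | .neg p => p

/-- Negation of a literal. -/
def Literal.compl : Literal → Literal
  | .pos p => .neg p
  | .neg p => .pos p

/-- Modal formulas, built from literals and the constants by `∧`, `∨`, `◇`, `□`. -/
inductive Fm : Type
  | lit (l : Literal) : Fm
  | bot : Fm
  | top : Fm
  | and (φ ψ : Fm) : Fm
  | or (φ ψ : Fm) : Fm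
  | dia (φ : Fm) : Fm
  | box (φ : Fm) : Fm

namespace Fm

/-- A variable as a formula. -/
def var (p : ℕ) : Fm := lit (.pos p)

/-- Negation, defined by the duality laws. -/
def neg : Fm → Fm
  | lit l => lit l.compl
  | bot => top
  | top => bot
  | and φ ψ => or φ.neg ψ.neg
  | or φ ψ => and φ.neg ψ.neg
  | dia φ => box φ.neg
  | box φ => dia φ.neg

/-- Implication `φ → ψ`. -/
def imp (φ ψ : Fm) : Fm := or φ.neg ψ

/-- Equivalence `φ ↔ ψ`. -/
def iff (φ ψ : Fm) : Fm := and (imp φ ψ) (imp ψ φ)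

/-- The set of literals occurring in a formula. -/
def lits : Fm → Set Literal
  | lit l => {l}
  | bot => ∅
  | top => ∅
  | and φ ψ => φ.lits ∪ ψ.lits
  | or φ ψ => φ.lits ∪ ψ.lits
  | dia φ => φ.lits
  | box φ => φ.lits

/-- The set of variables occurring in a formula. -/
def vars (φ : Fm) : Set ℕ := Literal.variable '' φ.lits

/-- Simultaneous substitution of `σ p` for every variable `p`
(a negated variable `¬p` becomes the negation of `σ p`). -/
def subst (σ : ℕ → Fm) : Fm → Fm
  | lit (.pos p) => σ p
  | lit (.neg p) => (σ p).neg
  | bot => bot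
  | top => top
  | and φ ψ => and (φ.subst σ) (ψ.subst σ)
  | or φ ψ => or (φ.subst σ) (ψ.subst σ)
  | dia φ => dia (φ.subst σ)
  | box φ => box (φ.subst σ)

/-- A formula of classical propositional logic: one without modalities. -/
def ModalFree : Fm → Prop
  | lit _ => True
  | bot => True
  | top => True
  | and φ ψ => φ.ModalFree ∧ ψ.ModalFree
  | or φ ψ => φ.ModalFree ∧ ψ.ModalFree
  | dia _ => False
  | box _ => False

/-- The classical truth value of a formula under an assignment; it is used for modality-free
formulas only (the value `False` at modal formulas is a dummy). -/
def boolTrue (b : ℕ → Prop) : Fm → Prop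
  | lit (.pos p) => b p
  | lit (.neg p) => ¬ b p
  | bot => False
  | top => True
  | and φ ψ => φ.boolTrue b ∧ ψ.boolTrue b
  | or φ ψ => φ.boolTrue b ∨ ψ.boolTrue b
  | dia _ => False
  | box _ => False

/-- Classical propositional tautologies. -/
def IsTautology (φ : Fm) : Prop := φ.ModalFree ∧ ∀ b : ℕ → Prop, φ.boolTrue b

end Fm

/-- Modal logics: sets of formulas that contain the classical tautologies and are closed under
modus ponens, substitution and the replacement rule for `◇`. -/
structure IsModalLogic (Λ : Set Fm) : Prop where
  tautology : ∀ φ : Fm, φ.IsTautology → φ ∈ Λ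
  modus_ponens : ∀ φ ψ : Fm, φ ∈ Λ → Fm.imp φ ψ ∈ Λ → ψ ∈ Λ
  substitution : ∀ (σ : ℕ → Fm) (φ : Fm), φ ∈ Λ → φ.subst σ ∈ Λ
  replacement : ∀ φ ψ : Fm, Fm.iff φ ψ ∈ Λ → Fm.iff (.dia φ) (.dia ψ) ∈ Λ

/-- Monotone logics: modal logics that contain the axiom `◇p → ◇(p ∨ q)`. -/
structure IsMonotoneLogic (Λ : Set Fm) : Prop extends IsModalLogic Λ where
  axiom_monotone :
    Fm.imp (.dia (.var 0)) (.dia (.or (.var 0) (.var 1))) ∈ Λ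

/-- `Λ`-equivalence of formulas. -/
def Equivalent (Λ : Set Fm) (φ ψ : Fm) : Prop := Fm.iff φ ψ ∈ Λ

/-- `φ` is `p`-positive: no variable of the tuple `p` occurs negated in `φ`. -/
def IsPositive {n : ℕ} (p : Fin n → ℕ) (φ : Fm) : Prop :=
  ∀ i, Literal.neg (p i) ∉ φ.lits

/-- `φ(p, r)` is `p`-monotone in `Λ`: the formula `φ(p, r) → φ(p ∨ q, r)` belongs to `Λ`, where
`q` is a tuple of pairwise distinct variables outside `p` and `r`. For a set `Λ` closed under
substitution it does not matter which tuple `q` of this kind is taken. -/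
def IsMonotoneIn (Λ : Set Fm) {n m : ℕ} (p : Fin n → ℕ) (r : Fin m → ℕ) (φ : Fm) : Prop :=
  ∃ q : Fin n → ℕ, Function.Injective q ∧ (∀ i j, q i ≠ p j) ∧ (∀ i j, q i ≠ r j) ∧
    Fm.imp φ (φ.subst (Function.extend p (fun i => .or (.var (p i)) (.var (q i))) .var)) ∈ Λ

/-- The graded Lyndon positivity property `LPP(n, m)`, for `n, m ≤ ω`, of a monotone logic `Λ`. -/
structure HasLPP (Λ : Set Fm) (n m : ℕ∞) : Prop where
  isMonotoneLogic : IsMonotoneLogic Λ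
  exists_positive : ∀ n' m' : ℕ, (n' : ℕ∞) ≤ n → (m' : ℕ∞) ≤ m →
    ∀ (p : Fin n' → ℕ) (r : Fin m' → ℕ),
      Function.Injective p → Function.Injective r → (∀ i j, p i ≠ r j) →
      ∀ φ : Fm, φ.vars ⊆ Set.range p ∪ Set.range r → IsMonotoneIn Λ p r φ →
        ∃ α : Fm, α.vars ⊆ Set.range p ∪ Set.range r ∧ IsPositive p α ∧ Equivalent Λ φ α

/-- Kripke frames. -/
structure KripkeFrame where
  World : Type
  Rel : World → World → Prop

namespace KripkeFrame

/-- The set of worlds at which a formula is true under the valuation `V`. -/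
def truthSet (F : KripkeFrame) (V : ℕ → Set F.World) : Fm → Set F.World
  | .lit (.pos p) => V p
  | .lit (.neg p) => (V p)ᶜ
  | .bot => ∅
  | .top => Set.univ
  | .and φ ψ => F.truthSet V φ ∩ F.truthSet V ψ
  | .or φ ψ => F.truthSet V φ ∪ F.truthSet V ψ
  | .dia φ => {w | ∃ v, F.Rel w v ∧ v ∈ F.truthSet V φ}
  | .box φ => {w | ∀ v, F.Rel w v → v ∈ F.truthSet V φ}

/-- The logic `Log F` of a Kripke frame: the set of all formulas valid in it. -/
def Log (F : KripkeFrame) : Set Fm :=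
  {φ | ∀ V : ℕ → Set F.World, F.truthSet V φ = Set.univ}

end KripkeFrame

/-- The cluster `C_k`, for `k ≤ ω`: the worlds are the natural numbers below `k`, and every world
is accessible from every world. -/
def cluster (k : ℕ∞) : KripkeFrame where
  World := {i : ℕ // (i : ℕ∞) < k}
  Rel := fun _ _ => True

end ModalLyndon

/-! In a cluster, truth of a formula at a world depends only on the world's type (its values of `p`,
`r`) and on the finite set of types realized, by bisimulation. Hence φ is a finite disjunction of
characteristic formulas of pairs (set of types, type). Deleting the negated `p` from these gives the
positive candidate; a disjunct then holds wherever the described model has a directed simulation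
into the given one, so the point is that monotone formulas are preserved by such simulations
(`mem_truthSet_of_directed_simulation`).

Monotonicity only compares two valuations on the same worlds. To reach this situation, take the
related pairs of types as new points. There are at most `2 ^ (2 * n + m)` of them, so `C_k` maps
onto them, and the two projections give comparable valuations on `C_k`, one bisimilar to each of the
original models. -/

namespace ModalLyndon

/-! ### Kripke semantics and soundness -/

namespace KripkeFrame

variable (F : KripkeFrame) (V : ℕ → Set F.World)

theorem truthSet_neg (φ : Fm) : F.truthSet V φ.neg = (F.truthSet V φ)ᶜ := by
  induction φ with
  | lit l => cases l <;> simp [Fm.neg, Literal.compl, truthSet]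
  | bot => simp [Fm.neg, truthSet]
  | top => simp [Fm.neg, truthSet]
  | and φ ψ h₁ h₂ => simp [Fm.neg, truthSet, h₁, h₂, Set.compl_inter]
  | or φ ψ h₁ h₂ => simp [Fm.neg, truthSet, h₁, h₂, Set.compl_union]
  | dia φ h => ext w; simp [Fm.neg, truthSet, h]
  | box φ h => ext w; simp [Fm.neg, truthSet, h]

theorem mem_truthSet_imp {φ ψ : Fm} {w : F.World} :
    w ∈ F.truthSet V (.imp φ ψ) ↔ (w ∈ F.truthSet V φ → w ∈ F.truthSet V ψ) := by
  simp only [Fm.imp, truthSet, truthSet_neg, Set.mem_union, Set.mem_compl_iff]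
  tauto

theorem mem_truthSet_iff {φ ψ : Fm} {w : F.World} :
    w ∈ F.truthSet V (.iff φ ψ) ↔ (w ∈ F.truthSet V φ ↔ w ∈ F.truthSet V ψ) := by
  simp only [Fm.iff, truthSet, Set.mem_inter_iff, mem_truthSet_imp]
  tauto

theorem truthSet_subst (σ : ℕ → Fm) (φ : Fm) :
    F.truthSet V (φ.subst σ) = F.truthSet (fun p => F.truthSet V (σ p)) φ := by
  induction φ with
  | lit l => cases l <;> simp [Fm.subst, truthSet, truthSet_neg]
  | bot => rfl
  | top => rfl
  | and φ ψ h₁ h₂ => simp [Fm.subst, truthSet, h₁, h₂]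
  | or φ ψ h₁ h₂ => simp [Fm.subst, truthSet, h₁, h₂]
  | dia φ h => simp [Fm.subst, truthSet, h]
  | box φ h => simp [Fm.subst, truthSet, h]

theorem mem_truthSet_iff_boolTrue {φ : Fm} (hφ : φ.ModalFree) (w : F.World) :
    w ∈ F.truthSet V φ ↔ φ.boolTrue (fun p => w ∈ V p) := by
  induction φ with
  | lit l => cases l <;> simp [Fm.boolTrue, truthSet]
  | bot => simp [Fm.boolTrue, truthSet]
  | top => simp [Fm.boolTrue, truthSet]
  | and φ ψ h₁ h₂ => simp [Fm.boolTrue, truthSet, h₁ hφ.1, h₂ hφ.2]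
  | or φ ψ h₁ h₂ => simp [Fm.boolTrue, truthSet, h₁ hφ.1, h₂ hφ.2]
  | dia φ h => exact hφ.elim
  | box φ h => exact hφ.elim

theorem mem_Log {φ : Fm} : φ ∈ F.Log ↔ ∀ V w, w ∈ F.truthSet V φ := by
  simp only [Log, Set.mem_ofPred_eq, Set.eq_univ_iff_forall]

theorem isMonotoneLogic_Log : IsMonotoneLogic F.Log where
  tautology φ h := F.mem_Log.2 fun V w => (F.mem_truthSet_iff_boolTrue V h.1 w).2 (h.2 _)
  modus_ponens φ ψ h₁ h₂ := F.mem_Log.2 fun V w =>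
    (F.mem_truthSet_imp V).1 (F.mem_Log.1 h₂ V w) (F.mem_Log.1 h₁ V w)
  substitution σ φ h := F.mem_Log.2 fun V w => by
    rw [truthSet_subst]
    exact F.mem_Log.1 h _ w
  replacement φ ψ h := F.mem_Log.2 fun V w => by
    have h' := fun v => (F.mem_truthSet_iff V).1 (F.mem_Log.1 h V v)
    simp only [mem_truthSet_iff, truthSet, Set.mem_ofPred_eq, h']
  axiom_monotone := F.mem_Log.2 fun V w => by
    rw [mem_truthSet_imp]
    rintro ⟨v, hv, hv'⟩
    exact ⟨v, hv, Or.inl hv'⟩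

end KripkeFrame

/-! ### Bisimulations and images of clusters -/

/-- In a cluster, a relation between worlds that is total in both directions and preserves
the values of the variables of a formula preserves its truth. -/
theorem cluster_bisimulation {k : ℕ∞} {V V' : ℕ → Set (cluster k).World}
    (R : (cluster k).World → (cluster k).World → Prop)
    (forth : ∀ w, ∃ w', R w w') (back : ∀ w', ∃ w, R w w') (φ : Fm)
    (atoms : ∀ x ∈ φ.vars, ∀ w w', R w w' → (w ∈ V x ↔ w' ∈ V' x)) :
    ∀ w w', R w w' →
      (w ∈ (cluster k).truthSet V φ ↔ w' ∈ (cluster k).truthSet V' φ) := by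
  induction φ with
  | lit l =>
    intro w w' h
    have := atoms l.variable ⟨l, rfl, rfl⟩ w w' h
    cases l with
    | pos x => exact this
    | neg x => exact not_congr this
  | bot => exact fun _ _ _ => Iff.rfl
  | top => exact fun _ _ _ => Iff.rfl
  | and φ ψ h₁ h₂ =>
    intro w w' h
    exact and_congr
      (h₁ (fun x hx => atoms x (Set.image_mono Set.subset_union_left hx)) w w' h)
      (h₂ (fun x hx => atoms x (Set.image_mono Set.subset_union_right hx)) w w' h)
  | or φ ψ h₁ h₂ =>
    intro w w' h
    exact or_congr
      (h₁ (fun x hx => atoms x (Set.image_mono Set.subset_union_left hx)) w w' h)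
      (h₂ (fun x hx => atoms x (Set.image_mono Set.subset_union_right hx)) w w' h)
  | dia φ ih =>
    intro w w' _
    constructor
    · rintro ⟨v, -, hv⟩
      obtain ⟨v', h⟩ := forth v
      exact ⟨v', trivial, (ih atoms v v' h).1 hv⟩
    · rintro ⟨v', -, hv⟩
      obtain ⟨v, h⟩ := back v'
      exact ⟨v, trivial, (ih atoms v v' h).2 hv⟩
  | box φ ih =>
    intro w w' _
    constructor
    · intro H v' _
      obtain ⟨v, h⟩ := back v'
      exact (ih atoms v v' h).1 (H v trivial)
    · intro H v _
      obtain ⟨v', h⟩ := forth v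
      exact (ih atoms v v' h).2 (H v' trivial)

/-- A nonempty finite type with at most `k` elements is an image of the cluster `C_k`. -/
theorem exists_surjective_cluster {k : ℕ∞} (Z : Type) [Finite Z] [Nonempty Z]
    (h : (Nat.card Z : ℕ∞) ≤ k) : ∃ g : (cluster k).World → Z, Function.Surjective g := by
  let f : Z → (cluster k).World := fun z =>
    ⟨Finite.equivFin Z z, lt_of_lt_of_le (by exact_mod_cast (Finite.equivFin Z z).2) h⟩
  have hf : Function.Injective f := fun x y hxy =>
    (Finite.equivFin Z).injective (Fin.ext (congrArg Subtype.val hxy))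
  -- Worlds outside the range of `f` go to an arbitrary point, so `k` may exceed the size of `Z` or
  -- be infinite.
  exact ⟨Function.invFun f, Function.invFun_surjective hf⟩

/-! ### Finite conjunctions and disjunctions -/

namespace Fm

/-- Finite conjunctions. -/
noncomputable def bigAnd {ι : Type} (s : Finset ι) (f : ι → Fm) : Fm :=
  (s.toList.map f).foldr .and .top

/-- Finite disjunctions. -/
noncomputable def bigOr {ι : Type} (s : Finset ι) (f : ι → Fm) : Fm :=
  (s.toList.map f).foldr .or .bot

theorem mem_truthSet_bigAnd {ι : Type} (s : Finset ι) (f : ι → Fm) (F : KripkeFrame)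
    (V : ℕ → Set F.World) (w : F.World) :
    w ∈ F.truthSet V (bigAnd s f) ↔ ∀ i ∈ s, w ∈ F.truthSet V (f i) := by
  have (l : List ι) : w ∈ F.truthSet V ((l.map f).foldr .and .top) ↔
      ∀ i ∈ l, w ∈ F.truthSet V (f i) := by
    induction l with
    | nil => simp [KripkeFrame.truthSet]
    | cons a l ih => simp [KripkeFrame.truthSet, ih]
  simp [bigAnd, this]

theorem mem_truthSet_bigOr {ι : Type} (s : Finset ι) (f : ι → Fm) (F : KripkeFrame)
    (V : ℕ → Set F.World) (w : F.World) :
    w ∈ F.truthSet V (bigOr s f) ↔ ∃ i ∈ s, w ∈ F.truthSet V (f i) := by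
  have (l : List ι) : w ∈ F.truthSet V ((l.map f).foldr .or .bot) ↔
      ∃ i ∈ l, w ∈ F.truthSet V (f i) := by
    induction l with
    | nil => simp [KripkeFrame.truthSet]
    | cons a l ih => simp [KripkeFrame.truthSet, ih]
  simp [bigOr, this]

theorem lits_bigAnd_subset {ι : Type} {s : Finset ι} {f : ι → Fm} {L : Set Literal}
    (h : ∀ i ∈ s, (f i).lits ⊆ L) : (bigAnd s f).lits ⊆ L := by
  have (l : List ι) (hl : ∀ i ∈ l, (f i).lits ⊆ L) :
      ((l.map f).foldr Fm.and .top).lits ⊆ L := by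
    induction l with
    | nil => simp [lits]
    | cons a l ih => simp_all [lits]
  exact this _ (by simpa using h)

theorem lits_bigOr_subset {ι : Type} {s : Finset ι} {f : ι → Fm} {L : Set Literal}
    (h : ∀ i ∈ s, (f i).lits ⊆ L) : (bigOr s f).lits ⊆ L := by
  have (l : List ι) (hl : ∀ i ∈ l, (f i).lits ⊆ L) :
      ((l.map f).foldr Fm.or .bot).lits ⊆ L := by
    induction l with
    | nil => simp [lits]
    | cons a l ih => simp_all [lits]
  exact this _ (by simpa using h)

end Fm

/-! ### Types and positive characteristic formulas -/

section PositiveTypes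

variable {n m : ℕ} (p : Fin n → ℕ) (r : Fin m → ℕ)

/-- The literals that may occur in a `p`-positive formula in the variables `p`, `r`. -/
def positiveLits : Set Literal :=
  {l | (∃ i, l = .pos (p i)) ∨ ∃ j, l = .pos (r j) ∨ l = .neg (r j)}

theorem vars_subset_of_positiveLits {α : Fm} (h : α.lits ⊆ positiveLits p r) :
    α.vars ⊆ Set.range p ∪ Set.range r := by
  rintro _ ⟨l, hl, rfl⟩
  rcases h hl with ⟨i, rfl⟩ | ⟨j, rfl | rfl⟩
  · exact Or.inl ⟨i, rfl⟩
  · exact Or.inr ⟨j, rfl⟩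
  · exact Or.inr ⟨j, rfl⟩

theorem isPositive_of_positiveLits (hpr : ∀ i j, p i ≠ r j) {α : Fm}
    (h : α.lits ⊆ positiveLits p r) : IsPositive p α := by
  intro i hi
  rcases h hi with ⟨j, hj⟩ | ⟨j, hj | hj⟩
  · cases hj
  · cases hj
  · exact hpr i j (Literal.neg.inj hj)

/-- The type of a world: the values of the variables `p` and `r` at it. -/
noncomputable def worldType {W : Type} (V : ℕ → Set W) (w : W) :
    (Fin n → Bool) × (Fin m → Bool) := by
  classical exact (fun i => decide (w ∈ V (p i)), fun j => decide (w ∈ V (r j)))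

/-- The conjunction of the literals of a type, without the negated variables of `p`. -/
noncomputable def positiveType (t : (Fin n → Bool) × (Fin m → Bool)) : Fm :=
  .and (.bigAnd (Finset.univ.filter fun i => t.1 i = true) fun i => .lit (.pos (p i)))
    (.bigAnd Finset.univ fun j => .lit (if t.2 j then .pos (r j) else .neg (r j)))

theorem lits_positiveType (t : (Fin n → Bool) × (Fin m → Bool)) :
    (positiveType p r t).lits ⊆ positiveLits p r := by
  refine Set.union_subset (Fm.lits_bigAnd_subset ?_) (Fm.lits_bigAnd_subset ?_)
  · rintro i - _ rfl
    exact Or.inl ⟨i, rfl⟩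
  · rintro j - _ rfl
    refine Or.inr ⟨j, ?_⟩
    split <;> simp

theorem mem_truthSet_positiveType (F : KripkeFrame) (V : ℕ → Set F.World) (w : F.World)
    (t : (Fin n → Bool) × (Fin m → Bool)) :
    w ∈ F.truthSet V (positiveType p r t) ↔
      t.1 ≤ (worldType p r V w).1 ∧ t.2 = (worldType p r V w).2 := by
  simp only [positiveType, KripkeFrame.truthSet, Set.mem_inter_iff, Fm.mem_truthSet_bigAnd,
    Finset.mem_filter, Finset.mem_univ, true_and, true_implies, worldType]
  refine and_congr ?_ ?_
  · simp [Pi.le_def, Bool.le_iff_imp]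
  · rw [funext_iff]
    refine forall_congr' fun j => ?_
    cases h : t.2 j <;> simp [KripkeFrame.truthSet]

/-- The positive part of the characteristic formula of a world of type `t` in a cluster whose
worlds have the types in `S`. -/
noncomputable def positiveChar (S : Finset ((Fin n → Bool) × (Fin m → Bool)))
    (t : (Fin n → Bool) × (Fin m → Bool)) : Fm :=
  .and (positiveType p r t)
    (.and (.bigAnd S fun u => .dia (positiveType p r u))
      (.box (.bigOr S (positiveType p r))))

theorem lits_positiveChar (S : Finset ((Fin n → Bool) × (Fin m → Bool)))
    (t : (Fin n → Bool) × (Fin m → Bool)) :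
    (positiveChar p r S t).lits ⊆ positiveLits p r :=
  Set.union_subset (lits_positiveType p r t) (Set.union_subset
    (Fm.lits_bigAnd_subset fun u _ => lits_positiveType p r u)
    (Fm.lits_bigOr_subset fun u _ => lits_positiveType p r u))

/-- Since accessibility is total, the diamonds and the box quantify over all worlds. They supply the
forth and back conditions of a directed simulation from a model with set of types `S`; the first
conjunct relates a world of type `t` to `w`. -/
theorem mem_truthSet_positiveChar {k : ℕ∞} (V : ℕ → Set (cluster k).World)
    (w : (cluster k).World) (S : Finset ((Fin n → Bool) × (Fin m → Bool)))
    (t : (Fin n → Bool) × (Fin m → Bool)) :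
    w ∈ (cluster k).truthSet V (positiveChar p r S t) ↔
      (t.1 ≤ (worldType p r V w).1 ∧ t.2 = (worldType p r V w).2) ∧
      (∀ u ∈ S, ∃ v, u.1 ≤ (worldType p r V v).1 ∧ u.2 = (worldType p r V v).2) ∧
      ∀ v, ∃ u ∈ S, u.1 ≤ (worldType p r V v).1 ∧ u.2 = (worldType p r V v).2 := by
  have hR (v v' : (cluster k).World) : (cluster k).Rel v v' ↔ True := Iff.rfl
  simp only [positiveChar, KripkeFrame.truthSet, Set.mem_inter_iff, Fm.mem_truthSet_bigAnd,
    Fm.mem_truthSet_bigOr, Set.mem_ofPred_eq, mem_truthSet_positiveType, hR, true_and,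
    true_implies]

/-- The variables `p`, `r` have the same values at worlds of the same type. -/
theorem mem_iff_of_worldType_eq {W : Type} {V V' : ℕ → Set W} {w w' : W}
    (h : worldType p r V w = worldType p r V' w') {x : ℕ}
    (hx : x ∈ Set.range p ∪ Set.range r) : w ∈ V x ↔ w' ∈ V' x := by
  simp only [worldType, Prod.mk.injEq, funext_iff, decide_eq_decide] at h
  rcases hx with ⟨i, rfl⟩ | ⟨j, rfl⟩
  · exact h.1 i
  · exact h.2 j

/-- In clusters, truth at a world depends on its type and on the set of all types only. -/
theorem mem_truthSet_iff_of_worldType {k : ℕ∞} {V V' : ℕ → Set (cluster k).World} {φ : Fm}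
    (hφ : φ.vars ⊆ Set.range p ∪ Set.range r)
    (hS : Set.range (worldType p r V) = Set.range (worldType p r V'))
    {w w' : (cluster k).World} (h : worldType p r V w = worldType p r V' w') :
    w ∈ (cluster k).truthSet V φ ↔ w' ∈ (cluster k).truthSet V' φ := by
  refine cluster_bisimulation (fun w w' => worldType p r V w = worldType p r V' w') ?_ ?_ φ
    (fun x hx w w' h => mem_iff_of_worldType_eq p r h (hφ hx)) w w' h
  · intro v
    obtain ⟨v', h⟩ := hS ▸ Set.mem_range_self (f := worldType p r V) v
    exact ⟨v', h.symm⟩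
  · intro v'
    have := Set.mem_range_self (f := worldType p r V') v'
    rwa [← hS] at this

/-! ### Preservation of monotone formulas -/

theorem truthSet_congr {F : KripkeFrame} {V V' : ℕ → Set F.World} {φ : Fm}
    (h : ∀ x ∈ φ.vars, V x = V' x) : F.truthSet V φ = F.truthSet V' φ := by
  induction φ with
  | lit l =>
    have := h l.variable ⟨l, rfl, rfl⟩
    cases l with
    | pos x => exact this
    | neg x => exact congrArg _ this
  | bot => rfl
  | top => rfl
  | and φ ψ h₁ h₂ =>
    exact congrArg₂ (· ∩ ·)
      (h₁ fun x hx => h x (Set.image_mono Set.subset_union_left hx))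
      (h₂ fun x hx => h x (Set.image_mono Set.subset_union_right hx))
  | or φ ψ h₁ h₂ =>
    exact congrArg₂ (· ∪ ·)
      (h₁ fun x hx => h x (Set.image_mono Set.subset_union_left hx))
      (h₂ fun x hx => h x (Set.image_mono Set.subset_union_right hx))
  | dia φ ih => simp only [KripkeFrame.truthSet, ih h]
  | box φ ih => simp only [KripkeFrame.truthSet, ih h]

/-- Monotone formulas are preserved when the values of the variables `p` grow. -/
theorem mem_truthSet_of_isMonotoneIn {F : KripkeFrame} (hp : Function.Injective p)
    {φ : Fm} (hφ : φ.vars ⊆ Set.range p ∪ Set.range r) (hmon : IsMonotoneIn F.Log p r φ)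
    {V V' : ℕ → Set F.World} (hle : ∀ i, V (p i) ⊆ V' (p i))
    (hV : ∀ j, V (r j) = V' (r j)) {w : F.World} (hw : w ∈ F.truthSet V φ) :
    w ∈ F.truthSet V' φ := by
  obtain ⟨q, hq, hqp, hqr, hΛ⟩ := hmon
  -- The fresh variables `q` carry the larger values, so that `p ∨ q` evaluates to `V' (p i)`, while
  -- `p` and `r` keep their values under `V`.
  let U : ℕ → Set F.World := Function.extend q (fun i => V' (p i)) V
  have hUq (i) : U (q i) = V' (p i) := hq.extend_apply _ _ i
  have hUp (i) : U (p i) = V (p i) :=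
    Function.extend_apply' _ _ _ fun ⟨j, hj⟩ => hqp j i hj
  have hUr (j) : U (r j) = V (r j) :=
    Function.extend_apply' _ _ _ fun ⟨i, hi⟩ => hqr i j hi
  have hU : F.truthSet U φ = F.truthSet V φ := truthSet_congr fun x hx => by
    rcases hφ hx with ⟨i, rfl⟩ | ⟨j, rfl⟩
    · exact hUp i
    · exact hUr j
  have hw' := (F.mem_truthSet_imp U).1 (F.mem_Log.1 hΛ U w) (hU ▸ hw)
  rw [F.truthSet_subst] at hw'
  refine (truthSet_congr fun x hx => ?_).subset hw'
  by_cases hx' : ∃ i, p i = x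
  · obtain ⟨i, rfl⟩ := hx'
    rw [hp.extend_apply]
    change U (p i) ∪ U (q i) = _
    rw [hUp, hUq, Set.union_eq_self_of_subset_left (hle i)]
  · obtain ⟨j, rfl⟩ := (hφ hx).resolve_left hx'
    rw [Function.extend_apply' _ _ _ hx']
    change U (r j) = _
    rw [hUr, hV]

/-- Worlds can be given arbitrary types by a valuation. -/
theorem exists_worldType_eq {W : Type} (hp : Function.Injective p) (hr : Function.Injective r)
    (hpr : ∀ i j, p i ≠ r j) (τ : W → (Fin n → Bool) × (Fin m → Bool)) :
    ∃ V : ℕ → Set W, worldType p r V = τ := by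
  refine ⟨fun x => {u | (∃ i, p i = x ∧ (τ u).1 i = true) ∨ ∃ j, r j = x ∧ (τ u).2 j = true}, ?_⟩
  funext u
  refine Prod.ext (funext fun i => ?_) (funext fun j => ?_)
  · simp [worldType, hp.eq_iff, fun j => (hpr i j).symm]
  · simp [worldType, hr.eq_iff, hpr]

/-- Monotone formulas are preserved by total and surjective relations between clusters that
increase the values of the variables `p` and preserve those of `r`. -/
theorem mem_truthSet_of_directed_simulation {k : ℕ∞} (hk : (2 : ℕ∞) ^ (2 * n + m) ≤ k)
    (hp : Function.Injective p) (hr : Function.Injective r) (hpr : ∀ i j, p i ≠ r j)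
    {φ : Fm} (hφ : φ.vars ⊆ Set.range p ∪ Set.range r)
    (hmon : IsMonotoneIn (cluster k).Log p r φ)
    {V V' : ℕ → Set (cluster k).World} {w w' : (cluster k).World}
    (hw : (worldType p r V w).1 ≤ (worldType p r V' w').1 ∧
      (worldType p r V w).2 = (worldType p r V' w').2)
    (forth : ∀ v, ∃ v', (worldType p r V v).1 ≤ (worldType p r V' v').1 ∧
      (worldType p r V v).2 = (worldType p r V' v').2)
    (back : ∀ v', ∃ v, (worldType p r V v).1 ≤ (worldType p r V' v').1 ∧
      (worldType p r V v).2 = (worldType p r V' v').2)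
    (hφw : w ∈ (cluster k).truthSet V φ) : w' ∈ (cluster k).truthSet V' φ := by
  -- A point is a related pair of realized types; their `r`-part is common and stored once.
  let Z := {z : ((Fin n → Bool) × (Fin n → Bool)) × (Fin m → Bool) // z.1.1 ≤ z.1.2 ∧
    (z.1.1, z.2) ∈ Set.range (worldType p r V) ∧ (z.1.2, z.2) ∈ Set.range (worldType p r V')}
  let pair (v v' : (cluster k).World) (h : (worldType p r V v).1 ≤ (worldType p r V' v').1 ∧
      (worldType p r V v).2 = (worldType p r V' v').2) : Z :=
    ⟨(((worldType p r V v).1, (worldType p r V' v').1), (worldType p r V v).2), h.1,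
      ⟨v, rfl⟩, ⟨v', Prod.ext rfl h.2.symm⟩⟩
  have : Nonempty Z := ⟨pair w w' hw⟩
  -- Two `p`-parts and one `r`-part give the exponent `2 * n + m`; the order and realizability
  -- constraints are ignored in the count.
  have hZ : Nat.card Z ≤ 2 ^ (2 * n + m) := by
    refine (Finite.card_subtype_le _).trans_eq ?_
    simp only [Nat.card_eq_fintype_card, Fintype.card_prod, Fintype.card_fun, Fintype.card_bool,
      Fintype.card_fin]
    ring
  obtain ⟨g, hg⟩ := exists_surjective_cluster (k := k) Z
    (le_trans (by exact_mod_cast hZ) hk)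
  obtain ⟨U, hU⟩ := exists_worldType_eq p r hp hr hpr fun u => ((g u).1.1.1, (g u).1.2)
  obtain ⟨U', hU'⟩ := exists_worldType_eq p r hp hr hpr fun u => ((g u).1.1.2, (g u).1.2)
  -- Each type realized under `V` is the first component of some point of `Z`, by `forth`; dually,
  -- `back` serves the second components.
  have hrange : Set.range (worldType p r V) = Set.range (worldType p r U) := by
    ext t
    constructor
    · rintro ⟨v, rfl⟩
      obtain ⟨v', h⟩ := forth v
      obtain ⟨u, hu⟩ := hg (pair v v' h)
      exact ⟨u, by rw [hU]; simp only [hu, pair]⟩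
    · rintro ⟨u, rfl⟩
      rw [hU]
      exact (g u).2.2.1
  have hrange' : Set.range (worldType p r U') = Set.range (worldType p r V') := by
    ext t
    constructor
    · rintro ⟨u, rfl⟩
      rw [hU']
      exact (g u).2.2.2
    · rintro ⟨v', rfl⟩
      obtain ⟨v, h⟩ := back v'
      obtain ⟨u, hu⟩ := hg (pair v v' h)
      exact ⟨u, by rw [hU']; simp only [hu, pair, h.2]⟩
  obtain ⟨u, hu⟩ := hg (pair w w' hw)
  -- Truth passes from `V` to `U` by bisimulation, from `U` to `U'` by monotonicity, and from `U'`
  -- to `V'` by bisimulation.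
  have hUu := (mem_truthSet_iff_of_worldType p r hφ hrange (w' := u)
    (by rw [hU]; simp only [hu, pair])).1 hφw
  refine (mem_truthSet_iff_of_worldType p r hφ hrange' (w := u)
    (by rw [hU']; simp only [hu, pair, hw.2])).1
    (mem_truthSet_of_isMonotoneIn p r hp hφ hmon (fun i v hv => ?_) (fun j => ?_) hUu)
  · have h₁ := congrFun (congrArg Prod.fst (congrFun hU v)) i
    have h₂ := congrFun (congrArg Prod.fst (congrFun hU' v)) i
    have h₃ := (g v).2.1 i
    simp only [worldType] at h₁ h₂
    rw [← h₁, ← h₂, Bool.le_iff_imp] at h₃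
    simpa [hv] using h₃
  · ext v
    have h₁ := congrFun (congrArg Prod.snd (congrFun hU v)) j
    have h₂ := congrFun (congrArg Prod.snd (congrFun hU' v)) j
    simpa [worldType] using h₁.trans h₂.symm

/-! ### The positive normal form -/

/-- Monotone formulas over a large enough cluster have positive equivalents. -/
theorem exists_positive_equivalent {k : ℕ∞} (hk : (2 : ℕ∞) ^ (2 * n + m) ≤ k)
    (hp : Function.Injective p) (hr : Function.Injective r) (hpr : ∀ i j, p i ≠ r j)
    {φ : Fm} (hφ : φ.vars ⊆ Set.range p ∪ Set.range r)
    (hmon : IsMonotoneIn (cluster k).Log p r φ) :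
    ∃ α : Fm, α.lits ⊆ positiveLits p r ∧ Equivalent (cluster k).Log φ α := by
  classical
  let models : Finset (Finset ((Fin n → Bool) × (Fin m → Bool)) ×
      ((Fin n → Bool) × (Fin m → Bool))) :=
    Finset.univ.filter fun x => ∃ V w, (x.1 : Set _) = Set.range (worldType p r V) ∧
      x.2 = worldType p r V w ∧ w ∈ (cluster k).truthSet V φ
  refine ⟨.bigOr models fun x => positiveChar p r x.1 x.2,
    Fm.lits_bigOr_subset fun x _ => lits_positiveChar p r x.1 x.2,
    (cluster k).mem_Log.2 fun V' w' => ?_⟩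
  rw [KripkeFrame.mem_truthSet_iff, Fm.mem_truthSet_bigOr]
  simp only [mem_truthSet_positiveChar]
  constructor
  · intro hw
    -- The disjunct of the model itself is satisfied, every type being related to itself.
    have hS := (Set.toFinite (Set.range (worldType p r V'))).coe_toFinset
    refine ⟨((Set.toFinite (Set.range (worldType p r V'))).toFinset, worldType p r V' w'),
      Finset.mem_filter.2 ⟨Finset.mem_univ _, V', w', hS, rfl, hw⟩, ⟨le_rfl, rfl⟩, ?_, ?_⟩
    · intro u hu
      obtain ⟨v, rfl⟩ := (Set.Finite.mem_toFinset _).1 hu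
      exact ⟨v, le_rfl, rfl⟩
    · exact fun v => ⟨_, (Set.Finite.mem_toFinset _).2 ⟨v, rfl⟩, le_rfl, rfl⟩
  · rintro ⟨⟨S, t⟩, hx, hw, forth, back⟩
    obtain ⟨-, V, w, hS, ht, hφw⟩ := Finset.mem_filter.1 hx
    simp only at hS ht hw forth back
    subst ht
    refine mem_truthSet_of_directed_simulation p r hk hp hr hpr hφ hmon hw ?_ ?_ hφw
    · intro v
      exact forth _ (Finset.mem_coe.1 (hS ▸ Set.mem_range_self v))
    · intro v'
      obtain ⟨u, hu, h⟩ := back v'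
      obtain ⟨v, rfl⟩ := hS ▸ Finset.mem_coe.2 hu
      exact ⟨v, h⟩

end PositiveTypes

end ModalLyndon

theorem mainTheorem8 (n m : ℕ) (k : ℕ∞) (hk : (2 : ℕ∞) ^ (2 * n + m) ≤ k) :
    ModalLyndon.HasLPP (ModalLyndon.cluster k).Log n m := by
  refine ⟨ModalLyndon.KripkeFrame.isMonotoneLogic_Log _,
    fun n' m' hn hm p r hp hr hpr φ hφ hmon => ?_⟩
  have hn' : n' ≤ n := by exact_mod_cast hn
  have hm' : m' ≤ m := by exact_mod_cast hm
  -- The bound for `n`, `m` covers all smaller tuples.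
  have hpow : 2 ^ (2 * n' + m') ≤ 2 ^ (2 * n + m) :=
    Nat.pow_le_pow_right two_pos (by omega)
  have hk' : (2 : ℕ∞) ^ (2 * n' + m') ≤ k := le_trans (by exact_mod_cast hpow) hk
  obtain ⟨α, hα, hφα⟩ :=
    ModalLyndon.exists_positive_equivalent p r hk' hp hr hpr hφ hmon
  exact ⟨α, ModalLyndon.vars_subset_of_positiveLits p r hα,
    ModalLyndon.isPositive_of_positiveLits p r hpr hα, hφα⟩
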